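/- **Theorem (planar rank-one convexity).** Let $\mu>0$, $\kappa>0$, $k\ge\frac14$ and $\widehat k\ge\frac18$. For $F\in\mathbb{R}^{2\times 2}$ let $U=\sqrt{F^TF}$ be the positive semidefinite square root of $F^TF$, and for $\det F>0$ let $\log U$ be the principal logarithm of the positive definite matrix $U$. Let $\|X\|^2=\operatorname{tr}(XX^T)$ be the squared Frobenius norm and $\operatorname{dev}_2X=X-\frac12\operatorname{tr}(X)\,\mathbb 1$. Define $W_{\rm eH}:\mathbb{R}^{2\times2}\to(0,\infty]$ by $$W_{\rm eH}(F)=\frac{\mu}{k}\,e^{k\,\|\operatorname{dev}_2\log U\|^2}+\frac{\kappa}{2\widehat k}\,e^{\widehat k\,(\log\det U)^2}\quad\text{if }\det F>0,\qquad W_{\rm eH}(F)=+\infty\quad\text{if }\det F\le0 .$$ Denote by $W^{\rm iso}_{\rm eH}(F)$ and $W^{\rm vol}_{\rm eH}(F)$ the first and the second summand for $\det F>0$. Then 1. $W_{\rm eH}(F)=W^{\rm iso}_{\rm eH}\big((\det F)^{-1/2}F\big)+W^{\rm vol}_{\rm eH}\big((\det F)^{1/2}\,\mathbb 1\big)$ for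 all $F\in{\rm GL}^+(2)=\{F\in\mathbb{R}^{2\times 2}:\det F>0\}$; 2. $W_{\rm eH}$ is rank-one convex on ${\rm GL}^+(2)$: for all $F\in{\rm GL}^+(2)$ and $\xi,\eta\in\mathbb{R}^2$ such that $F+t\,\xi\otimes\eta\in{\rm GL}^+(2)$ for all $t\in[0,1]$, and for all $\theta\in[0,1]$, $$W_{\rm eH}\big(F+(1-\theta)\,\xi\otimes\eta\big)\le\theta\,W_{\rm eH}(F)+(1-\theta)\,W_{\rm eH}(F+\xi\otimes\eta),$$ where $(\xi\otimes\eta)_{ij}=\xi_i\eta_j$; 3. the same inequality holds in $[0,\infty]$, with $0\cdot\infty=0$, for all $F\in\mathbb{R}^{2\times2}$, $\xi,\eta\in\mathbb{R}^2$ and $\theta\in[0,1]$; that is, $W_{\rm eH}$ is rank-one convex as an extended-valued function on $\mathbb{R}^{2\times2}$. -/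

import Mathlib

open scoped ENNReal MatrixOrder

noncomputable section

namespace Hencky

/-- `GL⁺(n)`, as the open set of real `n × n` matrices with positive determinant. -/
def GLPos (n : ℕ) : Set (Matrix (Fin n) (Fin n) ℝ) := {F | 0 < F.det}

/-- The right stretch tensor `U = √(Fᵀ F)`: the positive semidefinite square root of `Fᵀ F`. -/
def stretch {n : ℕ} (F : Matrix (Fin n) (Fin n) ℝ) : Matrix (Fin n) (Fin n) ℝ :=
  CFC.sqrt (F.transpose * F)

/-- The principal logarithm of a symmetric matrix: `Real.log` is applied to the eigenvalues. -/
def matLog {n : ℕ} (X : Matrix (Fin n) (Fin n) ℝ) : Matrix (Fin n) (Fin n) ℝ :=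
  cfc Real.log X

/-- The deviatoric part `dev_n X = X - (1/n) tr(X) 𝟙`. -/
def dev {n : ℕ} (X : Matrix (Fin n) (Fin n) ℝ) : Matrix (Fin n) (Fin n) ℝ :=
  X - ((1 / (n : ℝ)) * X.trace) • (1 : Matrix (Fin n) (Fin n) ℝ)

/-- The square of the Frobenius norm, `‖X‖² = tr (X Xᵀ)`. -/
def frobSq {n : ℕ} (X : Matrix (Fin n) (Fin n) ℝ) : ℝ := (X * X.transpose).trace

/-- The isochoric energy `(μ/k) exp (k ‖dev_n log U‖²)`. -/
def isoEnergy (n : ℕ) (μ k : ℝ) (F : Matrix (Fin n) (Fin n) ℝ) : ℝ :=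
  μ / k * Real.exp (k * frobSq (dev (matLog (stretch F))))

/-- The volumetric energy `(κ/(2k̂)) exp (k̂ (log det U)²)`. -/
def volEnergy (n : ℕ) (κ k' : ℝ) (F : Matrix (Fin n) (Fin n) ℝ) : ℝ :=
  κ / (2 * k') * Real.exp (k' * Real.log (stretch F).det ^ 2)

/-- The exponentiated Hencky energy
`W_eH(F) = (μ/k) exp (k ‖dev_n log U‖²) + (κ/(2k̂)) exp (k̂ (log det U)²)` if `det F > 0`,
and `W_eH(F) = +∞` if `det F ≤ 0`. -/
def expHencky (n : ℕ) (μ κ k k' : ℝ) (F : Matrix (Fin n) (Fin n) ℝ) : ℝ≥0∞ :=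
  if 0 < F.det then ENNReal.ofReal (isoEnergy n μ k F + volEnergy n κ k' F) else ⊤

/-- Rank-one convexity on a set `S` of matrices of an extended-valued function `W`: convexity
on all closed line segments in `S` whose end points differ by a dyad `ξ ⊗ η`, i.e.
`W (F + (1-θ) ξ⊗η) ≤ θ W(F) + (1-θ) W (F + ξ⊗η)` for `θ ∈ [0,1]`. -/
def RankOneConvexOn {n : ℕ} (S : Set (Matrix (Fin n) (Fin n) ℝ))
    (W : Matrix (Fin n) (Fin n) ℝ → ℝ≥0∞) : Prop :=
  ∀ F ∈ S, ∀ ξ η : Fin n → ℝ,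
    (∀ t ∈ Set.Icc (0 : ℝ) 1, F + t • Matrix.vecMulVec ξ η ∈ S) →
    ∀ θ ∈ Set.Icc (0 : ℝ) 1,
      W (F + (1 - θ) • Matrix.vecMulVec ξ η) ≤
        ENNReal.ofReal θ * W F + ENNReal.ofReal (1 - θ) * W (F + Matrix.vecMulVec ξ η)

end Hencky

end

/-! Let `λ₁ ≥ λ₂` be the singular values of `F` with `det F > 0`. In the plane `‖dev₂ log U‖² = ½
log² r` with `r = λ₁ / λ₂ = λ₁² / det F ≥ 1` (`exists_isMaxStretchSq`). Since `λ₁²` is the maximum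
of `|F v|²` over unit vectors, `r` is a maximum of the functions `|F v|² / det F`. Along a rank-one
segment `F v` and `det F` are affine, and `(p, d) ↦ p² / d` is convex for `d > 0`, so `r` is convex
there (`IsMaxStretchSq.div_det_le`).

The function `s ↦ exp (c log² s)` is convex on `s > 0` for `c ≥ 1/8` and nondecreasing on `s ≥ 1`.
Composing it with `r` (`c = k/2`) and with `det F` (`c = k'`) gives the two halves of the energy.
The split holds because `r` is unchanged by positive scaling of `F`. -/

namespace Hencky

open Matrix

/-! ### Scalar convexity -/

section Scalar

/-- `s ↦ exp (c log² s)` is convex on the positive half-line once `c ≥ 1/8`. -/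
theorem convexOn_exp_mul_log_sq {c : ℝ} (hc : 1 / 8 ≤ c) :
    ConvexOn ℝ (Set.Ioi 0) fun s : ℝ => Real.exp (c * Real.log s ^ 2) := by
  have hd : ∀ x ∈ Set.Ioi (0 : ℝ), HasDerivAt (fun s : ℝ => Real.exp (c * Real.log s ^ 2))
      (Real.exp (c * Real.log x ^ 2) * (2 * c * Real.log x / x)) x := by
    intro x hx
    have hx0 : x ≠ 0 := ne_of_gt hx
    refine (((Real.hasDerivAt_log hx0).pow 2).const_mul c).exp.congr_deriv ?_
    change Real.exp (c * Real.log x ^ 2) * (c * ((2 : ℕ) * Real.log x ^ (2 - 1) * x⁻¹)) = _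
    push_cast
    ring
  refine convexOn_of_hasDerivWithinAt2_nonneg (convex_Ioi 0)
    (f' := fun x => Real.exp (c * Real.log x ^ 2) * (2 * c * Real.log x / x))
    (f'' := fun x => Real.exp (c * Real.log x ^ 2) *
      (2 * c * (2 * c * Real.log x ^ 2 - Real.log x + 1) / x ^ 2))
    (fun x hx => (hd x hx).continuousAt.continuousWithinAt) ?_ ?_ ?_
  · intro x hx
    rw [interior_Ioi] at hx
    exact (hd x hx).hasDerivWithinAt
  · intro x hx
    rw [interior_Ioi] at hx
    have hx0 : x ≠ 0 := ne_of_gt hx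
    refine HasDerivAt.hasDerivWithinAt ?_
    refine ((hd x hx).mul (((Real.hasDerivAt_log hx0).const_mul (2 * c)).div
      (hasDerivAt_id' x) hx0)).congr_deriv ?_
    simp only [Pi.div_apply]
    field_simp
    ring
  · intro x hx
    -- With `L = log x`, the bound `c ≥ 1/8` leaves at least `L²/4 - L + 1 = (L - 2)²/4`; this is
    -- where the threshold comes from.
    have h : 0 ≤ 2 * c * Real.log x ^ 2 - Real.log x + 1 := by
      nlinarith [sq_nonneg (Real.log x - 2), mul_nonneg (sub_nonneg.2 hc) (sq_nonneg (Real.log x))]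
    have hc0 : 0 ≤ 2 * c := by linarith
    positivity

/-- The ratio of singular values is convex but not affine, so composition with it needs monotonicity
as well; `log` is nonnegative on `[1, ∞)`. -/
theorem monotoneOn_exp_mul_log_sq {c : ℝ} (hc : 0 ≤ c) :
    MonotoneOn (fun s : ℝ => Real.exp (c * Real.log s ^ 2)) (Set.Ici 1) := by
  intro x hx y _ hxy
  have hx' : (1 : ℝ) ≤ x := hx
  have h0 : 0 ≤ Real.log x := Real.log_nonneg hx'
  have h1 : Real.log x ≤ Real.log y := Real.log_le_log (by linarith) hxy
  dsimp only
  gcongr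

/-- The perspective of the square, `(p, d) ↦ p² / d` with `d > 0`, is convex. -/
theorem sq_div_convex_comb_le {p q d e a b : ℝ} (hd : 0 < d) (he : 0 < e) (ha : 0 ≤ a)
    (hb : 0 ≤ b) (hab : a + b = 1) :
    (a * p + b * q) ^ 2 / (a * d + b * e) ≤ a * (p ^ 2 / d) + b * (q ^ 2 / e) := by
  have hD : 0 < a * d + b * e := by
    rcases ha.lt_or_eq with h | h
    · positivity
    · have : b = 1 := by linarith
      subst this; rw [← h]; linarith
  -- Tangent planes: `p² / d` dominates functions linear in `(p, d)`, with equality at `r = p / d`.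
  have tangent : ∀ p d r : ℝ, 0 < d → 2 * r * p - r ^ 2 * d ≤ p ^ 2 / d := by
    intro p d r hd
    rw [le_div_iff₀ hd]
    nlinarith [sq_nonneg (p - r * d)]
  set r := (a * p + b * q) / (a * d + b * e) with hr
  have h1 := mul_le_mul_of_nonneg_left (tangent p d r hd) ha
  have h2 := mul_le_mul_of_nonneg_left (tangent q e r he) hb
  have h3 : (a * p + b * q) ^ 2 / (a * d + b * e) =
      2 * r * (a * p + b * q) - r ^ 2 * (a * d + b * e) := by
    rw [hr]; field_simp; ring
  rw [h3]; linarith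

end Scalar

/-! ### The stretch tensor -/

section Stretch

variable {n : ℕ}

theorem transpose_mul_self_nonneg (F : Matrix (Fin n) (Fin n) ℝ) : 0 ≤ Fᵀ * F :=
  (posSemidef_conjTranspose_mul_self F).nonneg

theorem stretch_posSemidef (F : Matrix (Fin n) (Fin n) ℝ) : (stretch F).PosSemidef :=
  nonneg_iff_posSemidef.1 (CFC.sqrt_nonneg _)

theorem stretch_mul_self (F : Matrix (Fin n) (Fin n) ℝ) : stretch F * stretch F = Fᵀ * F :=
  CFC.sqrt_mul_sqrt_self _ (transpose_mul_self_nonneg F)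

theorem det_stretch {F : Matrix (Fin n) (Fin n) ℝ} (hF : 0 ≤ F.det) :
    (stretch F).det = F.det := by
  have h := congrArg det (stretch_mul_self F)
  rw [det_mul, det_mul, det_transpose] at h
  exact (mul_self_inj (stretch_posSemidef F).det_nonneg hF).1 h

end Stretch

/-! ### Singular values in the plane -/

/-- For a function of a symmetric `2 × 2` matrix, the deviatoric part has squared Frobenius norm
`(f λ₀ - f λ₁)² / 2`, where `λ₀, λ₁` are the eigenvalues. -/
theorem frobSq_dev_cfc {A : Matrix (Fin 2) (Fin 2) ℝ} (hA : A.IsHermitian) (f : ℝ → ℝ) :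
    frobSq (dev (cfc f A)) = (f (hA.eigenvalues 0) - f (hA.eigenvalues 1)) ^ 2 / 2 := by
  -- This form needs only the trace and determinant of `cfc f A`, both invariant under conjugation.
  have key : ∀ X : Matrix (Fin 2) (Fin 2) ℝ, Xᵀ = X →
      frobSq (dev X) = X.trace ^ 2 / 2 - 2 * X.det := by
    intro X hX
    have h : X 1 0 = X 0 1 := congrFun (congrFun hX 0) 1
    simp only [frobSq, dev, trace_fin_two, det_fin_two, mul_apply, Fin.sum_univ_two,
      transpose_apply, Matrix.sub_apply, Matrix.smul_apply, one_apply, smul_eq_mul, h]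
    norm_num
    ring
  have hsym : (cfc f A)ᵀ = cfc f A := (cfc_predicate f A : IsSelfAdjoint (cfc f A))
  have htr : (cfc f A).trace = f (hA.eigenvalues 0) + f (hA.eigenvalues 1) := by
    rw [hA.cfc_eq, IsHermitian.cfc, Unitary.conjStarAlgAut_apply, trace_mul_cycle]
    simp
  have hdet : (cfc f A).det = f (hA.eigenvalues 0) * f (hA.eigenvalues 1) := by
    rw [hA.cfc_eq, IsHermitian.cfc, Unitary.conjStarAlgAut_apply, det_mul_comm, ← mul_assoc]
    simp
  rw [key _ hsym, htr, hdet]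
  ring

/-- `a` is the square of the largest singular value of `F`, i.e. the maximum of
`|F v|²` over unit vectors. -/
def IsMaxStretchSq (F : Matrix (Fin 2) (Fin 2) ℝ) (a : ℝ) : Prop :=
  (∀ v : Fin 2 → ℝ, (F *ᵥ v) ⬝ᵥ (F *ᵥ v) ≤ a * (v ⬝ᵥ v)) ∧
    ∃ v : Fin 2 → ℝ, v ⬝ᵥ v = 1 ∧ (F *ᵥ v) ⬝ᵥ (F *ᵥ v) = a

/-- Frees the energy from the choice of eigenvalues: any `a` known to be the maximum may be used in
the logarithmic formula. -/
theorem IsMaxStretchSq.unique {F : Matrix (Fin 2) (Fin 2) ℝ} {a b : ℝ} (ha : IsMaxStretchSq F a)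
    (hb : IsMaxStretchSq F b) : a = b := by
  obtain ⟨ha1, v, hv, hva⟩ := ha
  obtain ⟨hb1, w, hw, hwb⟩ := hb
  have h1 := hb1 v
  have h2 := ha1 w
  rw [hv, hva] at h1
  rw [hw, hwb] at h2
  linarith

theorem IsMaxStretchSq.smul {F : Matrix (Fin 2) (Fin 2) ℝ} {a : ℝ} (ha : IsMaxStretchSq F a)
    (c : ℝ) : IsMaxStretchSq (c • F) (c ^ 2 * a) := by
  obtain ⟨ha1, v, hv, hva⟩ := ha
  refine ⟨fun w => ?_, v, hv, ?_⟩
  · have := mul_le_mul_of_nonneg_left (ha1 w) (sq_nonneg c)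
    simp only [smul_mulVec, smul_dotProduct, dotProduct_smul, smul_eq_mul]
    linarith
  · simp only [smul_mulVec, smul_dotProduct, dotProduct_smul, smul_eq_mul, hva]
    ring

/-- A root `a` of the characteristic polynomial of `Fᵀ F` that is at least the other root is the
square of the largest singular value. -/
theorem isMaxStretchSq_of_root {F : Matrix (Fin 2) (Fin 2) ℝ} {a b : ℝ} (hab : b ≤ a)
    (hsum : (Fᵀ * F).trace = a + b) (hprod : (Fᵀ * F).det = a * b) : IsMaxStretchSq F a := by
  have hq : ∀ v : Fin 2 → ℝ, (F *ᵥ v) ⬝ᵥ (F *ᵥ v) = v ⬝ᵥ ((Fᵀ * F) *ᵥ v) := by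
    intro v
    rw [← mulVec_mulVec, dotProduct_mulVec v, vecMul_transpose]
  have hs : (Fᵀ * F) 1 0 = (Fᵀ * F) 0 1 := by
    simp [mul_apply, Fin.sum_univ_two, mul_comm]
  set A := Fᵀ * F with hA
  rw [trace_fin_two] at hsum
  have hdet : (a - A 0 0) * (a - A 1 1) = A 0 1 ^ 2 := by
    rw [det_fin_two, hs] at hprod
    linear_combination hprod - a * hsum
  refine ⟨fun v => ?_, ?_⟩
  · rw [hq]
    simp only [dotProduct, mulVec, Fin.sum_univ_two, hs]
    have hsum0 : 0 ≤ (a - A 0 0) + (a - A 1 1) := by linarith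
    have hprod0 : 0 ≤ (a - A 0 0) * (a - A 1 1) := hdet ▸ sq_nonneg _
    have hx : 0 ≤ a - A 0 0 := by nlinarith
    have hy : 0 ≤ a - A 1 1 := by nlinarith
    suffices h : 0 ≤ (a - A 0 0) * v 0 ^ 2 - 2 * A 0 1 * (v 0 * v 1) + (a - A 1 1) * v 1 ^ 2 by
      linarith
    rcases hsum0.lt_or_eq with h | h
    -- By `hdet`, the quadratic form times the sum of its diagonal coefficients is a sum of two
    -- squares.
    · refine nonneg_of_mul_nonneg_right (a := (a - A 0 0) + (a - A 1 1)) ?_ h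
      nlinarith [sq_nonneg ((a - A 0 0) * v 0 - A 0 1 * v 1),
        sq_nonneg ((a - A 1 1) * v 1 - A 0 1 * v 0)]
    · have h0 : a - A 0 0 = 0 := by linarith
      have h1 : a - A 1 1 = 0 := by linarith
      have h2 : A 0 1 = 0 := by
        rw [h0, zero_mul] at hdet
        exact pow_eq_zero_iff (two_ne_zero) |>.1 hdet.symm
      simp [h0, h1, h2]
  · have hdet' : (A - a • (1 : Matrix (Fin 2) (Fin 2) ℝ)).det = 0 := by
      simp [det_fin_two, hs]
      linear_combination hdet
    obtain ⟨v, hv0, hv⟩ := exists_mulVec_eq_zero_iff.2 hdet'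
    have hvpos : 0 < v ⬝ᵥ v := by
      have h0 : 0 ≤ v ⬝ᵥ v := Finset.sum_nonneg fun i _ => mul_self_nonneg (v i)
      exact h0.lt_of_ne fun h => hv0 (dotProduct_self_eq_zero.1 h.symm)
    have hAv : A *ᵥ v = a • v := by
      rw [sub_mulVec, smul_mulVec, one_mulVec, sub_eq_zero] at hv
      exact hv
    have hr : (Real.sqrt (v ⬝ᵥ v))⁻¹ * ((Real.sqrt (v ⬝ᵥ v))⁻¹ * (v ⬝ᵥ v)) = 1 := by
      have h := Real.sq_sqrt hvpos.le
      have h' := (Real.sqrt_pos.2 hvpos).ne'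
      field_simp
      exact h.symm
    refine ⟨(Real.sqrt (v ⬝ᵥ v))⁻¹ • v, ?_, ?_⟩
    · simpa only [smul_dotProduct, dotProduct_smul, smul_eq_mul] using hr
    · rw [hq]
      simp only [mulVec_smul, hAv, smul_dotProduct, dotProduct_smul, smul_eq_mul]
      linear_combination a * hr

/-- In the plane, `‖dev₂ log U‖² = ½ log² (λ₁ / λ₂)`, with
`λ₁ / λ₂ = λ₁² / det F` for the singular values `λ₁ ≥ λ₂`. -/
theorem exists_isMaxStretchSq {F : Matrix (Fin 2) (Fin 2) ℝ} (hF : 0 < F.det) :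
    ∃ a, IsMaxStretchSq F a ∧ F.det ≤ a ∧
      frobSq (dev (matLog (stretch F))) = Real.log (a / F.det) ^ 2 / 2 := by
  have hP := stretch_posSemidef F
  have hU := hP.isHermitian
  have hfrob : frobSq (dev (matLog (stretch F))) = _ := frobSq_dev_cfc hU Real.log
  have hdet : hU.eigenvalues 0 * hU.eigenvalues 1 = F.det := by
    rw [← det_stretch hF.le, hU.det_eq_prod_eigenvalues]
    simp
  have htr : (Fᵀ * F).trace = hU.eigenvalues 0 ^ 2 + hU.eigenvalues 1 ^ 2 := by
    have h1 : (stretch F).trace = hU.eigenvalues 0 + hU.eigenvalues 1 := by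
      rw [hU.trace_eq_sum_eigenvalues]; simp
    have h2 := det_stretch hF.le
    rw [← stretch_mul_self F]
    rw [trace_fin_two] at h1
    rw [det_fin_two] at h2
    simp only [trace_fin_two, mul_apply, Fin.sum_univ_two]
    linear_combination ((stretch F) 0 0 + (stretch F) 1 1 + hU.eigenvalues 0 + hU.eigenvalues 1) * h1
      - 2 * h2 + 2 * hdet
  have hdet2 : (Fᵀ * F).det = hU.eigenvalues 0 ^ 2 * hU.eigenvalues 1 ^ 2 := by
    rw [det_mul, det_transpose, ← hdet]; ring
  have h0 : 0 ≤ hU.eigenvalues 0 := hP.eigenvalues_nonneg 0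
  have h1 : 0 ≤ hU.eigenvalues 1 := hP.eigenvalues_nonneg 1
  generalize hU.eigenvalues 0 = x at *
  generalize hU.eigenvalues 1 = y at *
  have main : ∀ x y : ℝ, 0 ≤ x → 0 ≤ y → x * y = F.det → y ≤ x →
      (Fᵀ * F).trace = x ^ 2 + y ^ 2 → (Fᵀ * F).det = x ^ 2 * y ^ 2 →
      IsMaxStretchSq F (x ^ 2) ∧ F.det ≤ x ^ 2 ∧
        (Real.log x - Real.log y) ^ 2 / 2 = Real.log (x ^ 2 / F.det) ^ 2 / 2 := by
    intro x y hx hy hxy hle htr hdet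
    have hx0 : x ≠ 0 := by rintro rfl; simp [← hxy] at hF
    have hy0 : y ≠ 0 := by rintro rfl; simp [← hxy] at hF
    refine ⟨isMaxStretchSq_of_root (by gcongr) htr hdet, by nlinarith, ?_⟩
    rw [← Real.log_div hx0 hy0, ← hxy]
    congr 3
    field_simp
  rw [hfrob]
  rcases le_total y x with h | h
  · exact ⟨x ^ 2, main x y h0 h1 hdet h htr hdet2⟩
  · refine ⟨y ^ 2, ?_⟩
    have := main y x h1 h0 (by linarith) h (by linarith) (by linarith)
    rwa [sub_sq_comm] at this

theorem IsMaxStretchSq.frobSq_dev {F : Matrix (Fin 2) (Fin 2) ℝ} (hF : 0 < F.det) {a : ℝ}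
    (ha : IsMaxStretchSq F a) :
    F.det ≤ a ∧ frobSq (dev (matLog (stretch F))) = Real.log (a / F.det) ^ 2 / 2 := by
  obtain ⟨b, hb, h⟩ := exists_isMaxStretchSq hF
  rwa [ha.unique hb]

/-- The ratio `λ₁ / λ₂ = λ₁² / det F` of the singular values is convex along segments on which
`det` is affine and positive. -/
theorem IsMaxStretchSq.div_det_le {F G H : Matrix (Fin 2) (Fin 2) ℝ} {a b c s t : ℝ}
    (hF : 0 < F.det) (hG : 0 < G.det) (hs : 0 ≤ s) (ht : 0 ≤ t) (hst : s + t = 1)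
    (hH : H = s • F + t • G) (hdet : H.det = s * F.det + t * G.det)
    (ha : IsMaxStretchSq F a) (hb : IsMaxStretchSq G b) (hc : IsMaxStretchSq H c) :
    c / H.det ≤ s * (a / F.det) + t * (b / G.det) := by
  -- A maximizer for `H` is only a test vector for `F` and `G`, so their ratios are bounded below at
  -- `v`.
  obtain ⟨v, hv, hvc⟩ := hc.2
  have h1 := ha.1 v
  have h2 := hb.1 v
  rw [hv, mul_one] at h1 h2
  have hHv : H *ᵥ v = s • (F *ᵥ v) + t • (G *ᵥ v) := by
    rw [hH, add_mulVec, smul_mulVec, smul_mulVec]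
  have h3 : s * ((F *ᵥ v ⬝ᵥ F *ᵥ v) / F.det) + t * ((G *ᵥ v ⬝ᵥ G *ᵥ v) / G.det) ≤
      s * (a / F.det) + t * (b / G.det) := by gcongr
  refine le_trans ?_ h3
  rw [← hvc, hHv, hdet]
  have e (w : Fin 2 → ℝ) : w ⬝ᵥ w = w 0 ^ 2 + w 1 ^ 2 := by
    simp [dotProduct, Fin.sum_univ_two, sq]
  have h4 (i : Fin 2) := sq_div_convex_comb_le (p := (F *ᵥ v) i) (q := (G *ᵥ v) i) hF hG hs ht hst
  have h40 := h4 0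
  have h41 := h4 1
  simp only [e, Pi.add_apply, Pi.smul_apply, smul_eq_mul, add_div]
  linarith

/-- The `t²` coefficient is the determinant of a dyad, which vanishes. -/
theorem det_add_smul_vecMulVec (F : Matrix (Fin 2) (Fin 2) ℝ) (ξ η : Fin 2 → ℝ) (t : ℝ) :
    (F + t • vecMulVec ξ η).det = (1 - t) * F.det + t * (F + vecMulVec ξ η).det := by
  simp only [det_fin_two, Matrix.add_apply, Matrix.smul_apply, vecMulVec_apply, smul_eq_mul]
  ring

/-! ### Convexity of the energies -/

section Energy

variable {μ κ k k' : ℝ}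

theorem isoEnergy_nonneg (hμ : 0 < μ) (hk : 0 < k) (n : ℕ) (F : Matrix (Fin n) (Fin n) ℝ) :
    0 ≤ isoEnergy n μ k F := by
  unfold isoEnergy; positivity

theorem volEnergy_nonneg (hκ : 0 < κ) (hk' : 0 < k') (n : ℕ) (F : Matrix (Fin n) (Fin n) ℝ) :
    0 ≤ volEnergy n κ k' F := by
  unfold volEnergy; positivity

theorem isoEnergy_smul {F : Matrix (Fin 2) (Fin 2) ℝ} (hF : 0 < F.det) {c : ℝ} (hc : 0 < c) :
    isoEnergy 2 μ k (c • F) = isoEnergy 2 μ k F := by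
  obtain ⟨a, ha, -, h⟩ := exists_isMaxStretchSq hF
  have hd : (c • F).det = c ^ 2 * F.det := by simp
  have h' := ((ha.smul c).frobSq_dev (by rw [hd]; positivity)).2
  rw [isoEnergy, isoEnergy, h, h', hd, mul_div_mul_left _ _ (by positivity)]

theorem volEnergy_eq {n : ℕ} {F : Matrix (Fin n) (Fin n) ℝ} (hF : 0 ≤ F.det) :
    volEnergy n κ k' F = κ / (2 * k') * Real.exp (k' * Real.log F.det ^ 2) := by
  rw [volEnergy, det_stretch hF]

theorem isoEnergy_le (hμ : 0 < μ) (hk : 1 / 4 ≤ k) {F G H : Matrix (Fin 2) (Fin 2) ℝ} {s t : ℝ}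
    (hF : 0 < F.det) (hG : 0 < G.det) (hH0 : 0 < H.det) (hs : 0 ≤ s) (ht : 0 ≤ t)
    (hst : s + t = 1) (hH : H = s • F + t • G) (hdet : H.det = s * F.det + t * G.det) :
    isoEnergy 2 μ k H ≤ s * isoEnergy 2 μ k F + t * isoEnergy 2 μ k G := by
  obtain ⟨a, ha, haF, ha'⟩ := exists_isMaxStretchSq hF
  obtain ⟨b, hb, hbG, hb'⟩ := exists_isMaxStretchSq hG
  obtain ⟨c, hc, hcH, hc'⟩ := exists_isMaxStretchSq hH0
  have hle := IsMaxStretchSq.div_det_le hF hG hs ht hst hH hdet ha hb hc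
  have h1 : 1 ≤ c / H.det := (one_le_div hH0).2 hcH
  have h2 : 0 < a / F.det := div_pos (hF.trans_le haF) hF
  have h3 : 0 < b / G.det := div_pos (hG.trans_le hbG) hG
  -- The factor `½` in `½ log² r` turns `k ≥ 1/4` into `k/2 ≥ 1/8`.
  have hmono := monotoneOn_exp_mul_log_sq (c := k / 2) (by linarith) h1 (h1.trans hle) hle
  have hconv := (convexOn_exp_mul_log_sq (c := k / 2) (by linarith)).2 h2 h3 hs ht hst
  simp only [smul_eq_mul] at hmono hconv
  have hμk : 0 ≤ μ / k := div_nonneg hμ.le (by linarith)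
  have key := mul_le_mul_of_nonneg_left (hmono.trans hconv) hμk
  have e (x : ℝ) : k * (x ^ 2 / 2) = k / 2 * x ^ 2 := by ring
  simp only [isoEnergy, ha', hb', hc', e]
  linarith

theorem volEnergy_le (hκ : 0 < κ) (hk' : 1 / 8 ≤ k') {n : ℕ} {F G H : Matrix (Fin n) (Fin n) ℝ}
    {s t : ℝ} (hF : 0 < F.det) (hG : 0 < G.det) (hH0 : 0 < H.det) (hs : 0 ≤ s) (ht : 0 ≤ t)
    (hst : s + t = 1) (hdet : H.det = s * F.det + t * G.det) :
    volEnergy n κ k' H ≤ s * volEnergy n κ k' F + t * volEnergy n κ k' G := by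
  have hconv := (convexOn_exp_mul_log_sq hk').2 hF hG hs ht hst
  simp only [smul_eq_mul] at hconv
  have hκk : 0 ≤ κ / (2 * k') := div_nonneg hκ.le (by linarith)
  have key := mul_le_mul_of_nonneg_left hconv hκk
  rw [volEnergy_eq hF.le, volEnergy_eq hG.le, volEnergy_eq hH0.le, hdet]
  linarith

theorem expHencky_of_pos {n : ℕ} {F : Matrix (Fin n) (Fin n) ℝ} (hF : 0 < F.det) :
    expHencky n μ κ k k' F = ENNReal.ofReal (isoEnergy n μ k F + volEnergy n κ k' F) :=
  if_pos hF

theorem expHencky_split {F : Matrix (Fin 2) (Fin 2) ℝ} (hF : 0 < F.det) :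
    expHencky 2 μ κ k k' F = ENNReal.ofReal
      (isoEnergy 2 μ k ((F.det ^ (1 / 2 : ℝ))⁻¹ • F) +
        volEnergy 2 κ k' (F.det ^ (1 / 2 : ℝ) • (1 : Matrix (Fin 2) (Fin 2) ℝ))) := by
  have hpos : 0 < F.det ^ (1 / 2 : ℝ) := Real.rpow_pos_of_pos hF _
  have hd : (F.det ^ (1 / 2 : ℝ) • (1 : Matrix (Fin 2) (Fin 2) ℝ)).det = F.det := by
    rw [det_smul, det_one, mul_one, Fintype.card_fin, ← Real.sqrt_eq_rpow, Real.sq_sqrt hF.le]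
  rw [expHencky_of_pos hF, isoEnergy_smul hF (inv_pos.2 hpos), volEnergy_eq hF.le,
    volEnergy_eq (hd.symm ▸ hF.le), hd]

theorem expHencky_rankOneConvexOn_univ (hμ : 0 < μ) (hκ : 0 < κ) (hk : 1 / 4 ≤ k)
    (hk' : 1 / 8 ≤ k') : RankOneConvexOn Set.univ (expHencky 2 μ κ k k') := by
  rintro F - ξ η - θ ⟨hθ0, hθ1⟩
  -- At `θ = 0` and `θ = 1` the convention `0 * ⊤ = 0` gives equality. For other `θ` an endpoint of
  -- infinite energy makes the right side `⊤`, so both determinants may be taken positive.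
  rcases hθ0.eq_or_lt with rfl | hθ0'
  · simp
  rcases hθ1.eq_or_lt with rfl | hθ1'
  · simp
  have h1θ : 0 < 1 - θ := sub_pos.2 hθ1'
  have hdet := det_add_smul_vecMulVec F ξ η (1 - θ)
  rw [sub_sub_cancel] at hdet
  have hH : F + (1 - θ) • vecMulVec ξ η = θ • F + (1 - θ) • (F + vecMulVec ξ η) := by
    rw [smul_add, ← add_assoc, ← add_smul, add_sub_cancel, one_smul]
  generalize F + (1 - θ) • vecMulVec ξ η = H at *
  generalize F + vecMulVec ξ η = G at *
  by_cases hF : 0 < F.det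
  swap
  · simp [expHencky, hF, ENNReal.mul_top, hθ0']
  by_cases hG : 0 < G.det
  swap
  · simp [expHencky, hG, ENNReal.mul_top, hθ1']
  have hH0 : 0 < H.det := by rw [hdet]; positivity
  have hk0 : 0 < k := by linarith
  have hk0' : 0 < k' := by linarith
  have hst : θ + (1 - θ) = 1 := by ring
  have hiso := isoEnergy_le hμ hk hF hG hH0 hθ0 h1θ.le hst hH hdet
  have hvol := volEnergy_le hκ hk' hF hG hH0 hθ0 h1θ.le hst hdet
  have hEF := add_nonneg (isoEnergy_nonneg hμ hk0 2 F) (volEnergy_nonneg hκ hk0' 2 F)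
  have hEG := add_nonneg (isoEnergy_nonneg hμ hk0 2 G) (volEnergy_nonneg hκ hk0' 2 G)
  rw [expHencky_of_pos hF, expHencky_of_pos hG, expHencky_of_pos hH0, ← ENNReal.ofReal_mul hθ0,
    ← ENNReal.ofReal_mul h1θ.le, ← ENNReal.ofReal_add (by positivity) (by positivity)]
  exact ENNReal.ofReal_le_ofReal (by linarith)

end Energy

end Hencky

theorem mainTheorem1 (μ κ k k' : ℝ) (hμ : 0 < μ) (hκ : 0 < κ)
    (hk : 1 / 4 ≤ k) (hk' : 1 / 8 ≤ k') :
    -- the volumetric-isochoric split of the energy on `GL⁺(2)`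
    (∀ F ∈ Hencky.GLPos 2,
      Hencky.expHencky 2 μ κ k k' F = ENNReal.ofReal
        (Hencky.isoEnergy 2 μ k ((F.det ^ (1 / 2 : ℝ))⁻¹ • F) +
          Hencky.volEnergy 2 κ k' (F.det ^ (1 / 2 : ℝ) • (1 : Matrix (Fin 2) (Fin 2) ℝ)))) ∧
    -- rank-one convexity on `GL⁺(2)`, and as an extended-valued function on all 2 × 2 matrices
    Hencky.RankOneConvexOn (Hencky.GLPos 2) (Hencky.expHencky 2 μ κ k k') ∧
    Hencky.RankOneConvexOn Set.univ (Hencky.expHencky 2 μ κ k k') := by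
  have h := Hencky.expHencky_rankOneConvexOn_univ hμ hκ hk hk'
  exact ⟨fun F hF => Hencky.expHencky_split hF,
    fun F _ ξ η _ θ hθ => h F trivial ξ η (fun _ _ => trivial) θ hθ, h⟩
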